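/- Let $\sigma$ be a vocabulary of relation, constant and function symbols. A finite ordered $\sigma$-structure $\mathbf A$ has domain $A=\{0,\dots,n-1\}$, $n\ge 1$, with its natural order $\le$ (where $\le\,\notin\sigma$); put $\mathrm{Num}(\mathbf A)=\{0,\dots,\lceil\log_2 n\rceil-1\}$. Index logic has variables $x,y,z,\dots$ of the domain sort (ranging over $A$), variables $\mathtt x,\mathtt y,\dots$ of the numeric sort (ranging over $\mathrm{Num}(\mathbf A)$), and relation variables $X$ ranging over relations on $\mathrm{Num}(\mathbf A)$. Terms of the domain sort are built from domain variables by the constant and function symbols of $\sigma$; terms of the numeric sort are variables. Formulas are given by $$\varphi ::= t_1\le t_2\mid t_1=t_2\mid \mathtt x_1\le\mathtt x_2\mid R(t_1,\dots,t_k)\mid X(\mathtt x_1,\dots,\mathtt x_k)\mid(\varphi\wedge\varphi)\mid\neg\varphi\mid[\mathrm{IFP}_{\bar{\mathtt x},X}\varphi]\bar{\mathtt y}\mid t=\mathit{index}\{\mathtt x:\varphi\}\mid\exists x(x=\mathit{index}\{\mathtt x:\alpha\}\wedge\varphi)\mid\exists\mathtt x\,\varphi,$$ where $t,t_1,\dots,t_k$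 are terms of the domain sort, $\bar{\mathtt x}$ (pairwise distinct variables) and $\bar{\mathtt y}$ are tuples as long as the arity of $X$, and $x$ is not free in $\alpha$. The semantics is the usual one, where $[\mathrm{IFP}_{\bar{\mathtt x},X}\varphi]\bar{\mathtt y}$ says that $\bar{\mathtt y}$ is in the inflationary fixed point $\bigcup_i S^i$ ($S^0=\emptyset$, $S^{i+1}=S^i\cup F(S^i)$) of the operator $F(S)=\{\bar a:\varphi\text{ holds for } X=S,\ \bar{\mathtt x}=\bar a\}$, and $t=\mathit{index}\{\mathtt x:\varphi\}$ says that for every $j\in\mathrm{Num}(\mathbf A)$ the bit of $t$ at position $j$ (with value $2^j$) is $1$ iff $\varphi$ holds for $\mathtt x=j$. Two formulas are equivalent if they have the same truth value in all finite ordered $\sigma$-structures under all valuations. Theorem. Let $c$ and $d$ be two distinct constant symbols in $\sigma$. There is no index logic formula $\varphi$ that does not use the order predicate $\le$ on terms of the domain sort (it may use equality on them, and the order on the numeric sort) and that is equivalent to the formula $c\le d$. -/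

import Mathlib

universe u v

namespace IndexLogic

/-- The numeric sort of a structure with domain `{0, …, n - 1}`: the numbers
`0, …, ⌈log₂ n⌉ - 1`. -/
abbrev Num (n : ℕ) : Type := Fin (Nat.clog 2 n)

/-- Relation variables: countably many of every arity. They range over relations on the
numeric sort. -/
structure RelVar where
  arity : ℕ
  idx : ℕ
deriving DecidableEq

/-- Raw formulas of index logic with inflationary fixed points, over the vocabulary `L`
(constant symbols are the `0`-ary function symbols of `L`). The variables of the domain sort
and those of the numeric sort are two separate copies of `ℕ`; terms of the domain sort are
Mathlib's terms `L.Term ℕ`, and the only terms of the numeric sort are variables.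
Equality of domain terms is a separate atom, so that it stays available to formulas which do
not use the order on the domain sort. -/
inductive Formula (L : FirstOrder.Language.{u, v}) : Type (max u v)
  /-- `t₁ ≤ t₂` on the domain sort -/
  | domLe (t₁ t₂ : L.Term ℕ) : Formula L
  /-- `t₁ = t₂` on the domain sort -/
  | domEq (t₁ t₂ : L.Term ℕ) : Formula L
  /-- `x ≤ y` on the numeric sort -/
  | numLe (x y : ℕ) : Formula L
  /-- `R(t₁, …, tₖ)` -/
  | rel {k : ℕ} (R : L.Relations k) (ts : Fin k → L.Term ℕ) : Formula L
  /-- `X(x₁, …, xₖ)` -/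
  | relVar (X : RelVar) (xs : Fin X.arity → ℕ) : Formula L
  /-- `φ ∧ ψ` -/
  | and (φ ψ : Formula L) : Formula L
  /-- `¬ φ` -/
  | not (φ : Formula L) : Formula L
  /-- `[IFP_{xs, X} φ] ys` -/
  | ifp (X : RelVar) (xs : Fin X.arity → ℕ) (φ : Formula L) (ys : Fin X.arity → ℕ) : Formula L
  /-- `t = index{x : φ(x)}` -/
  | eqIndex (t : L.Term ℕ) (x : ℕ) (φ : Formula L) : Formula L
  /-- `∃ z (z = index{x : α(x)} ∧ φ)`, with `z` of the domain sort -/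
  | exIndex (z : ℕ) (x : ℕ) (α φ : Formula L) : Formula L
  /-- `∃ x φ`, with `x` of the numeric sort -/
  | exNum (x : ℕ) (φ : Formula L) : Formula L

/-- A valuation over a structure with domain `Fin n`. -/
structure Valuation (n : ℕ) where
  dom : ℕ → Fin n
  num : ℕ → Num n
  rel : (X : RelVar) → Set (Fin X.arity → Num n)

namespace Valuation

variable {n : ℕ}

/-- `val(a/z)` for a variable `z` of the domain sort. -/
def setDom (val : Valuation n) (z : ℕ) (a : Fin n) : Valuation n :=
  { val with dom := Function.update val.dom z a }

/-- `val(i/x)` for a variable `x` of the numeric sort. -/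
def setNum (val : Valuation n) (x : ℕ) (i : Num n) : Valuation n :=
  { val with num := Function.update val.num x i }

/-- `val(a₁/x₁, …, aₖ/xₖ)` for a tuple of pairwise distinct variables of the numeric sort. -/
noncomputable def setNums (val : Valuation n) {k : ℕ} (xs : Fin k → ℕ) (a : Fin k → Num n) :
    Valuation n :=
  { val with num := Function.extend xs a val.num }

/-- `val(S/X)` for a relation variable `X`. -/
def setRel (val : Valuation n) (X : RelVar) (S : Set (Fin X.arity → Num n)) : Valuation n :=
  { val with rel := Function.update val.rel X S }

end Valuation

/-- The stages `S⁰ = ∅`, `Sⁱ⁺¹ = Sⁱ ∪ F(Sⁱ)` of an operator on a power set. -/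
def inflStage {β : Type} (F : Set β → Set β) : ℕ → Set β
  | 0 => ∅
  | i + 1 => inflStage F i ∪ F (inflStage F i)

/-- The inflationary fixed point of an operator on a power set. -/
def inflFixedPoint {β : Type} (F : Set β → Set β) : Set β := ⋃ i, inflStage F i

namespace Formula

variable {L : FirstOrder.Language.{u, v}}

/-- The variables of the domain sort that occur free in a formula. -/
def freeDom : Formula L → Finset ℕ
  | domLe t₁ t₂ => t₁.varFinset ∪ t₂.varFinset
  | domEq t₁ t₂ => t₁.varFinset ∪ t₂.varFinset
  | numLe _ _ => ∅
  | rel _ ts => Finset.univ.biUnion fun i => (ts i).varFinset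
  | relVar _ _ => ∅
  | and φ ψ => φ.freeDom ∪ ψ.freeDom
  | not φ => φ.freeDom
  | ifp _ _ φ _ => φ.freeDom
  | eqIndex t _ φ => t.varFinset ∪ φ.freeDom
  | exIndex z _ α φ => (α.freeDom ∪ φ.freeDom).erase z
  | exNum _ φ => φ.freeDom

/-- The side conditions of the grammar, at every subformula: the variables bound by a fixed
point operator are pairwise distinct, and in `∃ z (z = index{x : α(x)} ∧ φ)` the variable `z`
is not free in `α`. -/
def WellFormed : Formula L → Prop
  | domLe _ _ => True
  | domEq _ _ => True
  | numLe _ _ => True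
  | rel _ _ => True
  | relVar _ _ => True
  | and φ ψ => φ.WellFormed ∧ ψ.WellFormed
  | not φ => φ.WellFormed
  | ifp _ xs φ _ => Function.Injective xs ∧ φ.WellFormed
  | eqIndex _ _ φ => φ.WellFormed
  | exIndex z _ α φ => z ∉ α.freeDom ∧ α.WellFormed ∧ φ.WellFormed
  | exNum _ φ => φ.WellFormed

/-- The formula does not use the order predicate on terms of the domain sort. -/
def DomOrderFree : Formula L → Prop
  | domLe _ _ => False
  | domEq _ _ => True
  | numLe _ _ => True
  | rel _ _ => True
  | relVar _ _ => True
  | and φ ψ => φ.DomOrderFree ∧ ψ.DomOrderFree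
  | not φ => φ.DomOrderFree
  | ifp _ _ φ _ => φ.DomOrderFree
  | eqIndex _ _ φ => φ.DomOrderFree
  | exIndex _ _ α φ => α.DomOrderFree ∧ φ.DomOrderFree
  | exNum _ φ => φ.DomOrderFree

/-- The satisfaction relation `A, val ⊨ φ`, for an ordered structure `A` with domain
`{0, …, n - 1}` carrying its natural order. Every element of the domain is less than
`2 ^ ⌈log₂ n⌉`, so it equals `index{x : φ(x)}` exactly when its bits at the positions
`j < ⌈log₂ n⌉` are as prescribed by `φ`. -/
def Realize {n : ℕ} [L.Structure (Fin n)] : Formula L → Valuation n → Prop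
  | domLe t₁ t₂, val => t₁.realize val.dom ≤ t₂.realize val.dom
  | domEq t₁ t₂, val => t₁.realize val.dom = t₂.realize val.dom
  | numLe x y, val => val.num x ≤ val.num y
  | rel R ts, val => FirstOrder.Language.Structure.RelMap R fun i => (ts i).realize val.dom
  | relVar X xs, val => (fun i => val.num (xs i)) ∈ val.rel X
  | and φ ψ, val => φ.Realize val ∧ ψ.Realize val
  | not φ, val => ¬ φ.Realize val
  | ifp X xs φ ys, val =>
      (fun i => val.num (ys i)) ∈
        inflFixedPoint fun S => {a | φ.Realize ((val.setRel X S).setNums xs a)}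
  | eqIndex t x φ, val =>
      ∀ j : Num n, (t.realize val.dom : Fin n).val.testBit j = true ↔ φ.Realize (val.setNum x j)
  | exIndex z x α φ, val =>
      ∃ a : Fin n,
        (∀ j : Num n, a.val.testBit j = true ↔ α.Realize ((val.setDom z a).setNum x j)) ∧
        φ.Realize (val.setDom z a)
  | exNum x φ, val => ∃ i : Num n, φ.Realize (val.setNum x i)

/-- Equivalence of formulas: the same truth value in every finite ordered structure (with
nonempty domain) under every valuation. -/
def Equivalent (φ ψ : Formula L) : Prop :=
  ∀ (n : ℕ) [NeZero n] [L.Structure (Fin n)] (val : Valuation n),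
    φ.Realize val ↔ ψ.Realize val

end Formula

end IndexLogic

/-! ### Inflationary stages, bit patterns and growth -/

namespace IndexLogic

/-! On a domain of size `2 ^ m`, let `d` denote `q`, let every other function symbol be constantly
`p`, and let all relations be empty. Without the domain order, a formula can examine `p` and `q`
only by comparing them with each other or with values `index{x : α}`. Evaluated symbolically, with
placeholders for `p` and `q`, it meets only polynomially many (in `m`) such values. Outside this
exceptional set `T`, its truth value does not depend on `p` and `q` (`exists_genericTruth`). As `2 ^
m` outgrows every polynomial, two distinct elements avoid `T`; exchanging them preserves the formula
but reverses `c ≤ d`. -/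

/-- The stages of an inflationary induction form a chain, hence there are at most
`Nat.card β + 1` of them. -/
theorem exists_finset_inflStage {β : Type} [Fintype β] (F : Set β → Set β) :
    ∃ C : Finset (Set β), (∀ i, inflStage F i ∈ C) ∧ C.card ≤ Fintype.card β + 1 := by
  classical
  have hmono : Monotone (inflStage F) :=
    monotone_nat_of_le_succ fun i => Set.subset_union_left
  have hfin : (Set.range (inflStage F)).Finite := Set.toFinite _
  refine ⟨hfin.toFinset, fun i => by simp, ?_⟩
  have hle : hfin.toFinset.card ≤ (Finset.range (Fintype.card β + 1)).card := by
    refine Finset.card_le_card_of_injOn Set.ncard ?_ ?_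
    · intro S _
      have h : S.ncard ≤ Nat.card β := Set.ncard_le_card S
      rw [Nat.card_eq_fintype_card] at h
      simpa [Nat.lt_succ_iff] using h
    · intro S hS S' hS' h
      simp only [Set.Finite.coe_toFinset, Set.mem_range] at hS hS'
      obtain ⟨i, rfl⟩ := hS
      obtain ⟨j, rfl⟩ := hS'
      rcases le_total i j with hij | hij
      · exact Set.eq_of_subset_of_ncard_le (hmono hij) h.ge
      · exact (Set.eq_of_subset_of_ncard_le (hmono hij) h.le).symm
  simpa using hle

/-- Agreement is required only along the stages of `G`. With `G` the symbolic operator, exceptional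
elements need be collected for its few stages only, not for all relations. -/
theorem inflFixedPoint_congr {β : Type} {F G : Set β → Set β}
    (h : ∀ i, F (inflStage G i) = G (inflStage G i)) : inflFixedPoint F = inflFixedPoint G := by
  have hs : ∀ i, inflStage F i = inflStage G i := by
    intro i
    induction i with
    | zero => rfl
    | succ i ih => simp only [inflStage, ih, h i]
  simp only [inflFixedPoint, hs]

/-- Every bit pattern on the numeric sort of a structure of size `2 ^ m` is that of a unique
element of the domain. -/
theorem exists_index {m : ℕ} (B : Num (2 ^ m) → Prop) :
    ∃ v : Fin (2 ^ m), ∀ a : Fin (2 ^ m),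
      (∀ j : Num (2 ^ m), a.val.testBit j = true ↔ B j) ↔ a = v := by
  classical
  have hm : Nat.clog 2 (2 ^ m) = m := Nat.clog_pow 2 m one_lt_two
  have hlt : Nat.ofBits (fun j => decide (B j)) < 2 ^ m :=
    (Nat.ofBits_lt_two_pow _).trans_eq (by rw [hm])
  refine ⟨⟨_, hlt⟩, fun a => ⟨fun h => ?_, ?_⟩⟩
  · refine Fin.ext (Nat.eq_of_testBit_eq fun i => ?_)
    by_cases hi : i < Nat.clog 2 (2 ^ m)
    · have := h ⟨i, hi⟩
      rw [Nat.testBit_ofBits_lt _ _ hi, Bool.eq_iff_iff, decide_eq_true_iff]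
      exact this
    · rw [Nat.testBit_ofBits_ge _ _ (not_lt.1 hi)]
      rw [hm, not_lt] at hi
      exact Nat.testBit_lt_two_pow (a.isLt.trans_le (Nat.pow_le_pow_right two_pos hi))
  · rintro rfl j
    simp [Nat.testBit_ofBits_lt _ _ j.isLt]

theorem exists_eval_add_lt_two_pow (P : Polynomial ℕ) (c : ℕ) :
    ∃ m : ℕ, P.eval m + c < 2 ^ m := by
  have key : ∀ Q : Polynomial ℕ,
      (fun m : ℕ => ((Q.eval m : ℕ) : ℝ)) =o[Filter.atTop] fun m : ℕ => (2 : ℝ) ^ m := by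
    intro Q
    induction Q using Polynomial.induction_on' with
    | add Q R hQ hR => simpa using hQ.add hR
    | monomial k a =>
      simpa using
        (isLittleO_pow_const_const_pow_of_one_lt (R := ℝ) k one_lt_two).const_mul_left (a : ℝ)
  -- The little-o bound is a weak inequality; the factor `1 / 2` makes it strict.
  have h := (key (P + Polynomial.C c)).bound (show (0 : ℝ) < 1 / 2 by norm_num)
  obtain ⟨m, hm⟩ := h.exists
  refine ⟨m, ?_⟩
  have hpos : (0 : ℝ) < 2 ^ m := by positivity
  simp only [Real.norm_natCast, norm_pow, Real.norm_ofNat, Polynomial.eval_add,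
    Polynomial.eval_C] at hm
  have : ((P.eval m + c : ℕ) : ℝ) < ((2 ^ m : ℕ) : ℝ) := by
    push_cast at hm ⊢
    linarith
  exact_mod_cast this

namespace Formula

variable {L : FirstOrder.Language.{u, v}}

/-- The truth value of a formula depends only on the values of its free variables of the
domain sort, besides those of the numeric and relation variables. -/
theorem realize_congr {n : ℕ} [L.Structure (Fin n)] (φ : Formula L) {dom dom' : ℕ → Fin n}
    (h : ∀ i ∈ φ.freeDom, dom i = dom' i) (num : ℕ → Num n)
    (rel : (X : RelVar) → Set (Fin X.arity → Num n)) :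
    φ.Realize ⟨dom, num, rel⟩ ↔ φ.Realize ⟨dom', num, rel⟩ := by
  have term : ∀ (t : L.Term ℕ) {e e' : ℕ → Fin n}, (∀ i ∈ t.varFinset, e i = e' i) →
      t.realize e = t.realize e' := by
    intro t e e' ht
    induction t with
    | var i => exact ht i (by simp [FirstOrder.Language.Term.varFinset])
    | func f ts ih =>
      simp only [FirstOrder.Language.Term.realize]
      congr 1
      funext k
      refine ih k fun i hi => ht i ?_
      simp only [FirstOrder.Language.Term.varFinset, Finset.mem_biUnion]
      exact ⟨k, Finset.mem_univ _, hi⟩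
  induction φ generalizing dom dom' num rel with
  | domLe t₁ t₂ =>
    simp only [freeDom, Finset.mem_union] at h
    simp only [Realize, term t₁ fun i hi => h i (.inl hi), term t₂ fun i hi => h i (.inr hi)]
  | domEq t₁ t₂ =>
    simp only [freeDom, Finset.mem_union] at h
    simp only [Realize, term t₁ fun i hi => h i (.inl hi), term t₂ fun i hi => h i (.inr hi)]
  | numLe x y => exact Iff.rfl
  | rel R ts =>
    have : ∀ k, (ts k).realize dom = (ts k).realize dom' := fun k =>
      term _ fun i hi => h i (Finset.mem_biUnion.2 ⟨k, Finset.mem_univ _, hi⟩)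
    simp only [Realize, this]
  | relVar X xs => exact Iff.rfl
  | and φ ψ ihφ ihψ =>
    simp only [freeDom, Finset.mem_union] at h
    exact and_congr (ihφ (fun i hi => h i (.inl hi)) _ _) (ihψ (fun i hi => h i (.inr hi)) _ _)
  | not φ ih => exact not_congr (ih h _ _)
  | ifp X xs φ ys ih =>
    simp only [Realize, Valuation.setRel, Valuation.setNums]
    simp only [ih h]
  | eqIndex t x φ ih =>
    simp only [freeDom, Finset.mem_union] at h
    simp only [Realize, Valuation.setNum, term t fun i hi => h i (.inl hi)]
    exact forall_congr' fun j => iff_congr Iff.rfl (ih (fun i hi => h i (.inr hi)) _ _)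
  | exIndex z x α φ ihα ihφ =>
    simp only [freeDom, Finset.mem_erase, Finset.mem_union] at h
    have hu : ∀ a i, (i ∈ α.freeDom ∨ i ∈ φ.freeDom) →
        Function.update dom z a i = Function.update dom' z a i := by
      intro a i hi
      by_cases hz : i = z
      · subst hz; simp
      · simp [hz, h i ⟨hz, hi⟩]
    simp only [Realize, Valuation.setNum, Valuation.setDom]
    exact exists_congr fun a => and_congr
      (forall_congr' fun j => iff_congr Iff.rfl (ihα (fun i hi => hu a i (.inl hi)) _ _))
      (ihφ (fun i hi => hu a i (.inr hi)) _ _)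
  | exNum x φ ih => exact exists_congr fun i => ih h _ _

end Formula

/-! ### Symbolic evaluation with placeholders -/

/-- The element denoted by a generic element: the elements `Sum.inr false` and `Sum.inr true`
are placeholders for `p` and `q`. -/
def instantiate {n : ℕ} (p q : Fin n) : Fin n ⊕ Bool → Fin n
  | .inl a => a
  | .inr false => p
  | .inr true => q

/-- The generic element `s` is a placeholder or an element different from `p` and `q`. -/
def Avoids {n : ℕ} (p q : Fin n) (s : Fin n ⊕ Bool) : Prop :=
  ∀ a, s = .inl a → a ≠ p ∧ a ≠ q

/-- This decides equality atoms symbolically. `Avoids` excludes the only collisions, such as `.inl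
p` with the placeholder for `p`. -/
theorem instantiate_inj {n : ℕ} {p q : Fin n} (hpq : p ≠ q) {s t : Fin n ⊕ Bool}
    (hs : Avoids p q s) (ht : Avoids p q t) :
    instantiate p q s = instantiate p q t ↔ s = t := by
  refine ⟨fun h => ?_, fun h => h ▸ rfl⟩
  rcases s with a | _ | _ <;> rcases t with b | _ | _ <;>
    simp_all [Avoids, instantiate, eq_comm]

variable {L : FirstOrder.Language.{u, v}}

open Classical in
/-- The generic value of a term in which the symbol `d` denotes `Sum.inr true` and every other
function symbol has the constant value `Sum.inr false`. -/
noncomputable def genericValue {n : ℕ} (d : L.Constants) (dom : ℕ → Fin n ⊕ Bool) :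
    L.Term ℕ → Fin n ⊕ Bool
  | .var i => dom i
  | .func (l := k) f _ => .inr (decide ((⟨k, f⟩ : Σ k, L.Functions k) = ⟨0, d⟩))

open Classical in
/-- The structure in which `d` denotes `q`, every other function symbol has the constant
value `p`, and all relations are empty. -/
@[reducible] noncomputable def twoPointStructure {n : ℕ} (d : L.Constants) (p q : Fin n) :
    L.Structure (Fin n) where
  funMap {k} f _ :=
    instantiate p q (.inr (decide ((⟨k, f⟩ : Σ k, L.Functions k) = ⟨0, d⟩)))
  RelMap _ _ := False

/-- Function symbols ignore their arguments, so only the head of a term matters and no induction is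
needed. -/
theorem realize_term {n : ℕ} (d : L.Constants) (p q : Fin n) (dom : ℕ → Fin n ⊕ Bool)
    (t : L.Term ℕ) :
    letI := twoPointStructure d p q
    t.realize (fun i => instantiate p q (dom i)) = instantiate p q (genericValue d dom t) := by
  cases t <;> rfl

theorem avoids_genericValue {n : ℕ} (d : L.Constants) {p q : Fin n} {dom : ℕ → Fin n ⊕ Bool}
    (h : ∀ i, Avoids p q (dom i)) (t : L.Term ℕ) : Avoids p q (genericValue d dom t) := by
  cases t with
  | var i => exact h i
  | func f ts => intro a ha; simp [genericValue] at ha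

theorem instantiate_update {n : ℕ} (p q : Fin n) (dom : ℕ → Fin n ⊕ Bool) (z : ℕ) (v : Fin n) :
    Function.update (fun i => instantiate p q (dom i)) z v =
      fun i => instantiate p q (Function.update dom z (.inl v) i) := by
  funext i
  by_cases h : i = z
  · subst h; simp [instantiate]
  · simp [h]

theorem avoids_update {n : ℕ} {p q : Fin n} {dom : ℕ → Fin n ⊕ Bool}
    (h : ∀ i, Avoids p q (dom i)) (z : ℕ) {v : Fin n} (hp : p ≠ v) (hq : q ≠ v) (i : ℕ) :
    Avoids p q (Function.update dom z (.inl v) i) := by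
  by_cases hi : i = z
  · subst hi
    intro a ha
    simp only [Function.update_self, Sum.inl.injEq] at ha
    exact ha ▸ ⟨hp.symm, hq.symm⟩
  · simpa [hi] using h i

/-- A formula has the truth value `b` in the structures `twoPointStructure d p q`, for all
distinct `p` and `q` outside `T`. -/
def GenericTruth (d : L.Constants) (φ : Formula L) {n : ℕ} (dom : ℕ → Fin n ⊕ Bool)
    (num : ℕ → Num n) (rel : (X : RelVar) → Set (Fin X.arity → Num n)) (T : Finset (Fin n))
    (b : Prop) : Prop :=
  ∀ p q : Fin n, p ≠ q → p ∉ T → q ∉ T → (∀ i, Avoids p q (dom i)) →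
    letI := twoPointStructure d p q
    (φ.Realize ⟨fun i => instantiate p q (dom i), num, rel⟩ ↔ b)

/-! ### Generic truth values, by induction on formulas -/

/-- A formula without domain order has a generic truth value, and the exceptional set is of
size polynomial in the size of the numeric sort. -/
theorem exists_genericTruth (d : L.Constants) (φ : Formula L) (hwf : φ.WellFormed)
    (hof : φ.DomOrderFree) :
    ∃ P : Polynomial ℕ, ∀ (m : ℕ) (dom : ℕ → Fin (2 ^ m) ⊕ Bool) (num : ℕ → Num (2 ^ m))
      (rel : (X : RelVar) → Set (Fin X.arity → Num (2 ^ m))),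
      ∃ (T : Finset (Fin (2 ^ m))) (b : Prop),
        T.card ≤ P.eval m ∧ GenericTruth d φ dom num rel T b := by
  classical
  have hcard : ∀ m, Fintype.card (Num (2 ^ m)) = m := fun m => by
    rw [Fintype.card_fin, Nat.clog_pow 2 m one_lt_two]
  induction φ with
  | domLe t₁ t₂ => exact hof.elim
  | domEq t₁ t₂ =>
    refine ⟨0, fun m dom num rel =>
      ⟨∅, genericValue d dom t₁ = genericValue d dom t₂, by simp, ?_⟩⟩
    intro p q hpq _ _ hav
    simp only [Formula.Realize, realize_term]
    exact instantiate_inj hpq (avoids_genericValue d hav _) (avoids_genericValue d hav _)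
  | numLe x y =>
    exact ⟨0, fun m dom num rel => ⟨∅, num x ≤ num y, by simp, fun _ _ _ _ _ _ => Iff.rfl⟩⟩
  | rel R ts =>
    exact ⟨0, fun m dom num rel => ⟨∅, False, by simp, fun _ _ _ _ _ _ => Iff.rfl⟩⟩
  | relVar X xs =>
    exact ⟨0, fun m dom num rel =>
      ⟨∅, (fun i => num (xs i)) ∈ rel X, by simp, fun _ _ _ _ _ _ => Iff.rfl⟩⟩
  | and φ ψ ihφ ihψ =>
    obtain ⟨P, hP⟩ := ihφ hwf.1 hof.1
    obtain ⟨Q, hQ⟩ := ihψ hwf.2 hof.2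
    refine ⟨P + Q, fun m dom num rel => ?_⟩
    obtain ⟨T, b, hT, hb⟩ := hP m dom num rel
    obtain ⟨T', b', hT', hb'⟩ := hQ m dom num rel
    refine ⟨T ∪ T', b ∧ b', ?_, ?_⟩
    · rw [Polynomial.eval_add]
      exact (Finset.card_union_le _ _).trans (add_le_add hT hT')
    · intro p q hpq hp hq hav
      simp only [Finset.mem_union, not_or] at hp hq
      exact and_congr (hb p q hpq hp.1 hq.1 hav) (hb' p q hpq hp.2 hq.2 hav)
  | not φ ih =>
    obtain ⟨P, hP⟩ := ih hwf hof
    refine ⟨P, fun m dom num rel => ?_⟩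
    obtain ⟨T, b, hT, hb⟩ := hP m dom num rel
    exact ⟨T, ¬ b, hT, fun p q hpq hp hq hav => not_congr (hb p q hpq hp hq hav)⟩
  | ifp X xs φ ys ih =>
    obtain ⟨P, hP⟩ := ih hwf.2 hof
    refine ⟨(Polynomial.X ^ X.arity + 1) * (Polynomial.X ^ X.arity * P),
      fun m dom num rel => ?_⟩
    choose T b hT hb using fun (S : Set (Fin X.arity → Num (2 ^ m))) a =>
      hP m dom (Function.extend xs a num) (Function.update rel X S)
    obtain ⟨C, hC, hCcard⟩ := exists_finset_inflStage fun S => {a | b S a}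
    have hβ : Fintype.card (Fin X.arity → Num (2 ^ m)) = m ^ X.arity := by
      rw [Fintype.card_fun, hcard, Fintype.card_fin]
    -- At most `m ^ k + 1` symbolic stages and `m ^ k` tuples, for `k` the arity of `X`, each
    -- contribute a set of size at most `P.eval m`.
    refine ⟨C.biUnion fun S => Finset.univ.biUnion fun a => T S a,
      (fun i => num (ys i)) ∈ inflFixedPoint fun S => {a | b S a}, ?_, ?_⟩
    · rw [hβ] at hCcard
      simp only [Polynomial.eval_mul, Polynomial.eval_add, Polynomial.eval_pow,
        Polynomial.eval_X, Polynomial.eval_one]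
      refine (Finset.card_biUnion_le_card_mul _ _ (m ^ X.arity * P.eval m) fun S _ => ?_).trans
        (Nat.mul_le_mul_right _ hCcard)
      refine (Finset.card_biUnion_le_card_mul _ _ _ fun a _ => hT S a).trans_eq ?_
      rw [Finset.card_univ, hβ]
    · intro p q hpq hp hq hav
      simp only [Finset.mem_biUnion, Finset.mem_univ, true_and, not_exists, not_and] at hp hq
      simp only [Formula.Realize, Valuation.setRel, Valuation.setNums]
      rw [inflFixedPoint_congr]
      intro i
      ext a
      exact hb _ a p q hpq (hp _ (hC i) a) (hq _ (hC i) a) hav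
  | eqIndex t x φ ih =>
    obtain ⟨P, hP⟩ := ih hwf hof
    refine ⟨Polynomial.X * P + 1, fun m dom num rel => ?_⟩
    choose T b hT hb using fun j => hP m dom (Function.update num x j) rel
    -- `v` has the generic truth values as its bits, so it is fixed before `p` and `q`; putting it
    -- into the exceptional set keeps it distinct from both.
    obtain ⟨v, hv⟩ := exists_index b
    refine ⟨insert v (Finset.univ.biUnion T), genericValue d dom t = .inl v, ?_, ?_⟩
    · simp only [Polynomial.eval_mul, Polynomial.eval_add, Polynomial.eval_X,
        Polynomial.eval_one]
      refine (Finset.card_insert_le _ _).trans (Nat.succ_le_succ ?_)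
      refine (Finset.card_biUnion_le_card_mul _ _ _ fun j _ => hT j).trans_eq ?_
      rw [Finset.card_univ, hcard]
    · intro p q hpq hp hq hav
      simp only [Finset.mem_insert, Finset.mem_biUnion, Finset.mem_univ, true_and, not_or,
        not_exists] at hp hq
      simp only [Formula.Realize, Valuation.setNum, realize_term]
      rw [forall_congr' fun j => iff_congr Iff.rfl (hb j p q hpq (hp.2 j) (hq.2 j) hav), hv]
      refine instantiate_inj (t := .inl v) hpq (avoids_genericValue d hav t) ?_
      intro a ha
      cases ha
      exact ⟨Ne.symm hp.1, Ne.symm hq.1⟩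
  | exIndex z x α φ ihα ihφ =>
    obtain ⟨P, hP⟩ := ihα hwf.2.1 hof.1
    obtain ⟨Q, hQ⟩ := ihφ hwf.2.2 hof.2
    refine ⟨Polynomial.X * P + Q + 1, fun m dom num rel => ?_⟩
    choose T b hT hb using fun j => hP m dom (Function.update num x j) rel
    obtain ⟨v, hv⟩ := exists_index b
    -- Since `v` is the only possible witness, the domain quantifier becomes a substitution of `v`
    -- for `z`.
    obtain ⟨T', b', hT', hb'⟩ := hQ m (Function.update dom z (.inl v)) num rel
    refine ⟨insert v (Finset.univ.biUnion T ∪ T'), b', ?_, ?_⟩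
    · simp only [Polynomial.eval_mul, Polynomial.eval_add, Polynomial.eval_X,
        Polynomial.eval_one]
      refine (Finset.card_insert_le _ _).trans (Nat.succ_le_succ ?_)
      refine (Finset.card_union_le _ _).trans (add_le_add ?_ hT')
      refine (Finset.card_biUnion_le_card_mul _ _ _ fun j _ => hT j).trans_eq ?_
      rw [Finset.card_univ, hcard]
    · intro p q hpq hp hq hav
      simp only [Finset.mem_insert, Finset.mem_union, Finset.mem_biUnion, Finset.mem_univ,
        true_and, not_or, not_exists] at hp hq
      let _ := twoPointStructure d p q
      -- As `z` is not free in `α`, the bits prescribed by `α` do not depend on the candidate `a`.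
      have hα : ∀ (a : Fin (2 ^ m)) j,
          α.Realize ⟨Function.update (fun i => instantiate p q (dom i)) z a,
            Function.update num x j, rel⟩ ↔ b j := by
        intro a j
        refine Iff.trans (Formula.realize_congr α ?_ _ _)
          (hb j p q hpq (hp.2.1 j) (hq.2.1 j) hav)
        intro i hi
        rw [Function.update_of_ne]
        rintro rfl
        exact hwf.1 hi
      simp only [Formula.Realize, Valuation.setNum, Valuation.setDom]
      simp only [hα, hv, exists_eq_left]
      rw [instantiate_update]
      exact hb' p q hpq hp.2.2 hq.2.2 (avoids_update hav z hp.1 hq.1)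
  | exNum x φ ih =>
    obtain ⟨P, hP⟩ := ih hwf hof
    refine ⟨Polynomial.X * P, fun m dom num rel => ?_⟩
    choose T b hT hb using fun j => hP m dom (Function.update num x j) rel
    refine ⟨Finset.univ.biUnion T, ∃ j, b j, ?_, ?_⟩
    · rw [Polynomial.eval_mul, Polynomial.eval_X]
      refine (Finset.card_biUnion_le_card_mul _ _ _ fun j _ => hT j).trans_eq ?_
      rw [Finset.card_univ, hcard]
    · intro p q hpq hp hq hav
      simp only [Finset.mem_biUnion, Finset.mem_univ, true_and, not_exists] at hp hq
      exact exists_congr fun j => hb j p q hpq (hp j) (hq j) hav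

theorem realize_domLe_twoPointStructure {c d : L.Constants} (hcd : c ≠ d) {n : ℕ} (p q : Fin n)
    (val : Valuation n) :
    letI := twoPointStructure d p q
    ((Formula.domLe c.term d.term).Realize val ↔ p ≤ q) := by
  have hc : (⟨0, c⟩ : Σ k, L.Functions k) ≠ ⟨0, d⟩ := fun h => hcd (eq_of_heq (Sigma.mk.inj h).2)
  simp only [Formula.Realize, FirstOrder.Language.Constants.term,
    FirstOrder.Language.Term.realize, FirstOrder.Language.Structure.funMap]
  simp only [hc, decide_false, decide_true]
  rfl

end IndexLogic

theorem theorem4 (L : FirstOrder.Language.{u, v}) (c d : L.Constants) (hcd : c ≠ d) :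
    ¬ ∃ φ : IndexLogic.Formula L, φ.WellFormed ∧ φ.DomOrderFree ∧
      φ.Equivalent (IndexLogic.Formula.domLe c.term d.term) := by
  rintro ⟨φ, hwf, hof, heq⟩
  obtain ⟨P, hP⟩ := IndexLogic.exists_genericTruth d φ hwf hof
  -- The summand `2` leaves room for two elements outside `T`. It also excludes `m = 0`, where the
  -- numeric sort is empty and there are no valuations.
  obtain ⟨m, hm⟩ := IndexLogic.exists_eval_add_lt_two_pow P 2
  have hm0 : m ≠ 0 := by
    rintro rfl
    simp at hm
  have hnum : 0 < Nat.clog 2 (2 ^ m) := by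
    rw [Nat.clog_pow 2 m one_lt_two]
    exact Nat.pos_of_ne_zero hm0
  obtain ⟨T, b, hT, hb⟩ := hP m (fun _ => .inr false) (fun _ => ⟨0, hnum⟩) fun _ => ∅
  have hcard : 1 < (Tᶜ).card := by
    rw [Finset.card_compl, Fintype.card_fin]
    omega
  obtain ⟨p, hp, q, hq, hpq⟩ := Finset.one_lt_card.1 hcard
  rw [Finset.mem_compl] at hp hq
  -- `b` and `T` were chosen before `p` and `q`, so this applies to both `(p, q)` and `(q, p)`.
  have key : ∀ p q : Fin (2 ^ m), p ≠ q → p ∉ T → q ∉ T → (p ≤ q ↔ b) := by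
    intro p q hpq hp hq
    let _ := IndexLogic.twoPointStructure d p q
    have h := heq (2 ^ m) ⟨fun _ => p, fun _ => ⟨0, hnum⟩, fun _ => ∅⟩
    rw [IndexLogic.realize_domLe_twoPointStructure hcd] at h
    exact h.symm.trans (hb p q hpq hp hq fun i a ha => by cases ha)
  have h₁ := key p q hpq hp hq
  have h₂ := key q p hpq.symm hq hp
  rcases le_total p q with h | h
  · exact hpq (le_antisymm h (h₂.2 (h₁.1 h)))
  · exact hpq (le_antisymm (h₁.2 (h₂.1 h)) h)
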